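/- **Setting.** Let $\mathcal F$ be the class of continuous (atomless) probability distributions on $[0,\infty)$ with finite mean. For $F\in\mathcal F$ and integers $n\ge k\ge 1$, let $\mathrm{OPT}_{n,k}(F)=\sum_{i=1}^k \mathbf E[X^{(i)}]$, where $X^{(i)}$ is the $i$-th largest of $n$ independent samples from $F$. For $m\ge k$ and $q\in[0,1]$, let $\mathrm{ALG}_{m,k}(F,q)$ be the expected sum of the values collected by the algorithm which observes $m$ independent samples from $F$ one by one and accepts the first $k$ (or all, if there are fewer) that are at least $T$, where $F(T)=1-q$, $T \ge 0$. The single-threshold competitive ratio is $$\gamma_{m,n,k}=\inf_{F\in\mathcal F}\ \sup_{q\in[0,1]}\ \frac{\mathrm{ALG}_{m,k}(F,q)}{\mathrm{OPT}_{n,k}(F)} .$$ For $\varepsilon\in(0,1)$ put $$\beta_{k,n}(\varepsilon)=\inf\{m/n:\ m\in\mathbb N,\ m\ge k,\ \gamma_{m,n,k}\ge 1-\varepsilon\},\qquad \beta_k(\varepsilon)=\sup_{n\ge k}\beta_{k,n}(\varepsilon),$$ and let $\bar\beta_k(\varepsilon)$ be the smallest sufficient scaling, i.e. the infimum of all $b\ge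 0$ such that $\gamma_{m,n,k}\ge 1-\varepsilon$ for all integers $n,m\ge k$ with $m\ge bn$. **Theorem.** 1. Let $k=1$ and $\varepsilon\in(0,1)$. Then the $(1-\varepsilon)$-competition complexity of single-threshold algorithms is exactly $\ln(1/\varepsilon)$: we have $\bar\beta_1(\varepsilon)=\ln(1/\varepsilon)$, and the scaling $b=\ln(1/\varepsilon)$ itself is sufficient. Moreover $\beta_{1,n}(\varepsilon)\le \ln(1/\varepsilon)+1/n$ for every $n\ge1$, $\lim_{n\to\infty}\beta_{1,n}(\varepsilon)=\ln(1/\varepsilon)$, and $\beta_1(\varepsilon)=\ln(1/\varepsilon)$ whenever $\varepsilon\le e^{-2}$. 2. Let $k>1$ and $\varepsilon\in(0,1)$. Then $$\frac{\ln(1/\varepsilon)}{k}\ \le\ \bar\beta_k(\varepsilon)\ \le\ \beta_k(\varepsilon)\ \le\ 1+\frac{2\ln(1/\varepsilon)}{k-1}+\sqrt{\frac{2\ln(1/\varepsilon)}{k-1}} .$$ 3. Consequently, any constant-fraction increase in the number of observations yields a ratio $1-\exp(-\Theta(k))$: for every $\delta>0$ there are constants $c,C>0$ such that for every $k\ge1$: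 $\beta_k(e^{-ck})\le 1+\delta$; $\gamma_{m,n,k}\ge 1-e^{-ck}$ for all integers $n\ge k$ and $m\ge(1+\delta)n$; and $\inf_{n\ge k}\gamma_{\lceil(1+\delta)n\rceil,n,k}\le 1-e^{-Ck}$. -/

import Mathlib

namespace SingleThreshold

open MeasureTheory ProbabilityTheory
open scoped ENNReal

/-- The class of continuous distributions over `[0, ∞)` (no atoms, i.e. continuous distribution
function) with finite mean. -/
def continuousDistributions : Set (Measure ℝ) :=
  {μ | IsProbabilityMeasure μ ∧ NullSingletonClass μ ∧ μ (Set.Iio 0) = 0 ∧ ∫⁻ x, ENNReal.ofReal x ∂μ ≠ ⊤}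

/-- The `(i + 1)`-st largest entry of the vector `x` (`Tuple.sort x` sorts `x` increasingly and
`Fin.rev` reverses the order). -/
noncomputable def orderStat {n : ℕ} (x : Fin n → ℝ) (i : Fin n) : ℝ :=
  x (Tuple.sort x i.rev)

/-- The prophet's value: the sum of the expectations of the `k` largest of `n` independent
samples from `μ`. -/
noncomputable def prophetValue (n k : ℕ) (μ : Measure ℝ) : ℝ≥0∞ :=
  ∑ i ∈ Finset.univ.filter (fun i : Fin n => (i : ℕ) < k),
    ∫⁻ x : Fin n → ℝ, ENNReal.ofReal (orderStat x i) ∂(Measure.pi fun _ => μ)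

/-- The reward, on the sequence `x`, of the algorithm which accepts one by one the values that are
at least `T`, until `k` values have been accepted. -/
noncomputable def thresholdReward {m : ℕ} (k : ℕ) (T : ℝ) (x : Fin m → ℝ) : ℝ :=
  ∑ i : Fin m,
    if T ≤ x i ∧ (Finset.univ.filter fun j : Fin m => j < i ∧ T ≤ x j).card < k then x i else 0

/-- The expected reward of the single-threshold algorithm with threshold `T` on `m` independent
samples from `μ`. -/
noncomputable def algValue (m k : ℕ) (μ : Measure ℝ) (T : ℝ) : ℝ≥0∞ :=
  ∫⁻ x : Fin m → ℝ, ENNReal.ofReal (thresholdReward k T x) ∂(Measure.pi fun _ => μ)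

/-- The single-threshold `(m, n, k)`-competitive ratio: the worst case over all continuous
distributions of the best ratio, over all quantiles `q ∈ [0, 1]` and thresholds `T` with
`F T = 1 - q`, between the value of the single-threshold algorithm on `m` samples and the value of
the prophet on `n` samples. -/
noncomputable def competitiveRatio (m n k : ℕ) : ℝ≥0∞ :=
  ⨅ μ ∈ continuousDistributions, ⨆ q ∈ Set.Icc (0 : ℝ) 1,
    ⨆ T ∈ {T : ℝ | 0 ≤ T ∧ cdf μ T = 1 - q}, algValue m k μ T / prophetValue n k μ

/-- `β_{k,n}(ε)`: the infimum of `m / n` over the integers `m ≥ k` for which the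
`(m, n, k)`-competitive ratio is at least `1 - ε`. -/
noncomputable def betaAt (k n : ℕ) (ε : ℝ) : ℝ≥0∞ :=
  ⨅ m ∈ {m : ℕ | k ≤ m ∧ ENNReal.ofReal (1 - ε) ≤ competitiveRatio m n k}, (m : ℝ≥0∞) / n

/-- `β_k(ε) = sup_{n ≥ k} β_{k,n}(ε)`. -/
noncomputable def beta (k : ℕ) (ε : ℝ) : ℝ≥0∞ :=
  ⨆ n ∈ Set.Ici k, betaAt k n ε

/-- The scaling `b` suffices: for every `n ≥ k`, every sequence length `m ≥ b n` (with `m ≥ k`)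
gives a competitive ratio of at least `1 - ε`. -/
def IsSufficientScaling (k : ℕ) (ε : ℝ) (b : ℝ≥0∞) : Prop :=
  ∀ n m : ℕ, k ≤ n → k ≤ m → b * n ≤ m → ENNReal.ofReal (1 - ε) ≤ competitiveRatio m n k

/-- The smallest scaling `b` such that, for all `n ≥ k`, every sequence length `m ≥ b n` suffices. -/
noncomputable def scalingBeta (k : ℕ) (ε : ℝ) : ℝ≥0∞ :=
  sInf {b : ℝ≥0∞ | IsSufficientScaling k ε b}

end SingleThreshold

/-!
The ratios are controlled by two estimates at the quantile `q = k / n`.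

Lower bound. For a threshold `T`, independence of the current sample from the earlier ones factors
the value of the algorithm as `(∫_{t ≥ T} t dμ) * S`, where `S` is the expected number of positions
at which fewer than `k` values have been accepted; applied to the constant `1` this gives
`q * S = E[min(N, k)]`, with `N` the binomial number of samples above `T`
(`lintegral_sum_accepted`, `measure_Ici_mul_expectedOpen`). The prophet collects at most
`k * T + n * E[(X - T)⁺]`, which at `q = k / n` equals `n * ∫_{t ≥ T} t dμ`. Hence the ratio is at
least `P(N ≥ k)` (`measure_mul_prophetValue_le`). For `k = 1` this is `1 - (1 - 1 / n) ^ m`, and in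
general a Chernoff bound for the lower tail of `N` applies (`le_competitiveRatio_chernoff`).

Upper bound. Let the samples be almost constant, equal to `1`, except for a very rare and very large
value of expectation `A`. The prophet gets about `k + n * A`, whereas the algorithm gets at most
`k * (1 - (1 - q) ^ m) * (q + A) / q`, because it accepts at most `k` values, and none with
probability `(1 - q) ^ m`. Choosing `A` such that `q ↦ q + A` is proportional to the tangent of
`q ↦ q / (1 - (1 - q) ^ m)` at `k / n` makes `q = k / n` optimal (`exists_tangent`), and the ratio
is at most `1 - (1 - k / n) ^ m` (`competitiveRatio_le`).

For `k = 1` the two bounds agree, so `m` must be `log (1 / ε)` times `-1 / log (1 - 1 / n)`, which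
is at most `n - 1 / 2`; once `log (1 / ε) ≥ 2`, the missing `1 / 2` makes room for rounding `m` down.
For `k > 1` the Chernoff bound with `m * k / n ≥ a * (k - 1)` reads
`P(N < k) ≤ exp (-(k - 1) * (a - 1 - log a))`; the slack of `k - 1` against `k` absorbs the rounding
(`beta_le_of_chernoff`), and `log (1 + s + √s) ≤ √s + s / 2` gives the stated scaling.
-/

namespace SingleThreshold

open MeasureTheory ProbabilityTheory
open scoped ENNReal

/-! ### The value of a threshold algorithm -/

/-- The number of entries of `x` that are at least `T`. -/
noncomputable def hits {m : ℕ} (T : ℝ) (x : Fin m → ℝ) : ℕ :=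
  (Finset.univ.filter fun j : Fin m => T ≤ x j).card

/-- The number of entries of `x` strictly before position `i` that are at least `T`. -/
noncomputable def hitsBefore {m : ℕ} (T : ℝ) (x : Fin m → ℝ) (i : Fin m) : ℕ :=
  (Finset.univ.filter fun j : Fin m => j < i ∧ T ≤ x j).card

/-- The expected number of positions at which the algorithm has not yet accepted `k` values. -/
noncomputable def expectedOpen (m k : ℕ) (μ : Measure ℝ) (T : ℝ) : ℝ≥0∞ :=
  ∑ i : Fin m, (Measure.pi fun _ => μ) {x : Fin m → ℝ | hitsBefore T x i < k}

lemma measurable_hits {m : ℕ} (T : ℝ) : Measurable (fun x : Fin m → ℝ => hits T x) := by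
  unfold hits
  simp_rw [Finset.card_filter]
  refine Finset.measurable_sum _ fun j _ => Measurable.ite ?_ measurable_const measurable_const
  exact measurableSet_le measurable_const (measurable_pi_apply j)

lemma measurable_hitsBefore {m : ℕ} (T : ℝ) (i : Fin m) :
    Measurable (fun x : Fin m → ℝ => hitsBefore T x i) := by
  unfold hitsBefore
  simp_rw [Finset.card_filter]
  refine Finset.measurable_sum _ fun j _ => Measurable.ite ?_ measurable_const measurable_const
  by_cases h : j < i
  · simpa [h] using measurableSet_le measurable_const (measurable_pi_apply j)
  · simp [h]

/-- The number of earlier hits depends only on earlier entries, so it is independent of the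
current one. -/
lemma indepFun_hitsBefore {m : ℕ} (μ : Measure ℝ) [IsProbabilityMeasure μ] (T : ℝ) (i : Fin m) :
    IndepFun (fun x : Fin m → ℝ => x i) (fun x => hitsBefore T x i) (Measure.pi fun _ => μ) := by
  have h := (iIndepFun_pi (μ := fun _ : Fin m => μ) (X := fun _ => (id : ℝ → ℝ))
    (fun _ => aemeasurable_id)).indepFun_finset {i} (Finset.Iio i) (by simp)
    (fun j => measurable_pi_apply j)
  have h1 : Measurable (fun y : ↥({i} : Finset (Fin m)) → ℝ => y ⟨i, by simp⟩) :=
    measurable_pi_apply _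
  have h2 : Measurable (fun y : ↥(Finset.Iio i) → ℝ =>
      (Finset.univ.filter fun j => T ≤ y j).card) := by
    simp_rw [Finset.card_filter]
    refine Finset.measurable_sum _ fun j _ => Measurable.ite ?_ measurable_const measurable_const
    exact measurableSet_le measurable_const (measurable_pi_apply j)
  have h3 := h.comp h1 h2
  convert h3 using 1
  · rfl
  funext x
  change hitsBefore T x i = (Finset.univ.filter fun j : ↥(Finset.Iio i) => T ≤ x j).card
  unfold hitsBefore
  symm
  refine Finset.card_bij (fun a _ => (a : Fin m)) ?_ ?_ ?_
  · intro a ha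
    simp only [Finset.mem_filter, Finset.mem_univ, true_and] at ha ⊢
    exact ⟨Finset.mem_Iio.1 a.2, ha⟩
  · intro a _ b _ hab
    exact Subtype.ext hab
  · intro b hb
    simp only [Finset.mem_filter, Finset.mem_univ, true_and] at hb
    exact ⟨⟨b, by simpa using hb.1⟩, by simpa using hb.2, rfl⟩

/-- The expected total of `f` over the accepted values factors by independence. -/
lemma lintegral_sum_accepted (m k : ℕ) (μ : Measure ℝ) [IsProbabilityMeasure μ] (T : ℝ)
    {f : ℝ → ℝ≥0∞} (hf : Measurable f) :
    ∫⁻ x : Fin m → ℝ, ∑ i, (if T ≤ x i ∧ hitsBefore T x i < k then f (x i) else 0)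
        ∂(Measure.pi fun _ => μ) =
      (∫⁻ t in Set.Ici T, f t ∂μ) * expectedOpen m k μ T := by
  have hg : Measurable ((Set.Ici T).indicator f) := hf.indicator measurableSet_Ici
  have hs : ∀ i : Fin m, MeasurableSet {x : Fin m → ℝ | hitsBefore T x i < k} := fun i =>
    measurableSet_lt (measurable_hitsBefore T i) measurable_const
  have hsplit : ∀ (x : Fin m → ℝ) (i : Fin m),
      (if T ≤ x i ∧ hitsBefore T x i < k then f (x i) else 0) =
      (Set.Ici T).indicator f (x i) * {x : Fin m → ℝ | hitsBefore T x i < k}.indicator 1 x := by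
    intro x i
    by_cases h1 : T ≤ x i <;> by_cases h2 : hitsBefore T x i < k <;> simp [h1, h2]
  simp_rw [hsplit]
  rw [lintegral_finsetSum]
  · unfold expectedOpen
    rw [Finset.mul_sum]
    refine Finset.sum_congr rfl fun i _ => ?_
    have hind : IndepFun (fun x : Fin m → ℝ => (Set.Ici T).indicator f (x i))
        ({x : Fin m → ℝ | hitsBefore T x i < k}.indicator (1 : (Fin m → ℝ) → ℝ≥0∞))
        (Measure.pi fun _ => μ) := by
      have h2 : Measurable (fun c : ℕ => if c < k then (1 : ℝ≥0∞) else 0) :=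
        measurable_from_top
      have heq : {x : Fin m → ℝ | hitsBefore T x i < k}.indicator (1 : (Fin m → ℝ) → ℝ≥0∞) =
          (fun c : ℕ => if c < k then (1 : ℝ≥0∞) else 0) ∘ fun x => hitsBefore T x i := by
        funext x
        by_cases h : hitsBefore T x i < k <;> simp [h]
      rw [heq]
      exact (indepFun_hitsBefore μ T i).comp hg h2
    have hmul := lintegral_mul_eq_lintegral_mul_lintegral_of_indepFun''
      (hg.comp (measurable_pi_apply i)).aemeasurable
      (measurable_one.indicator (hs i)).aemeasurable hind
    simp only [Function.comp] at hmul
    rw [hmul, lintegral_indicator_one (hs i),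
      ← lintegral_indicator measurableSet_Ici]
    congr 1
    exact (measurePreserving_eval (fun _ : Fin m => μ) i).lintegral_comp hg
  · intro i _
    exact (hg.comp (measurable_pi_apply i)).mul (measurable_one.indicator (hs i))

lemma ofReal_thresholdReward {m : ℕ} (k : ℕ) {T : ℝ} (hT : 0 ≤ T) (x : Fin m → ℝ) :
    ENNReal.ofReal (thresholdReward k T x) =
      ∑ i, (if T ≤ x i ∧ hitsBefore T x i < k then ENNReal.ofReal (x i) else 0) := by
  unfold thresholdReward
  rw [ENNReal.ofReal_sum_of_nonneg]
  · refine Finset.sum_congr rfl fun i _ => ?_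
    unfold hitsBefore
    split_ifs <;> simp
  · intro i _
    split_ifs with h
    · exact hT.trans h.1
    · exact le_rfl

lemma algValue_eq (m k : ℕ) (μ : Measure ℝ) [IsProbabilityMeasure μ] {T : ℝ} (hT : 0 ≤ T) :
    algValue m k μ T =
      (∫⁻ t in Set.Ici T, ENNReal.ofReal t ∂μ) * expectedOpen m k μ T := by
  unfold algValue
  simp_rw [ofReal_thresholdReward k hT]
  exact lintegral_sum_accepted m k μ T ENNReal.measurable_ofReal

lemma hitsBefore_castSucc {m : ℕ} (T : ℝ) (x : Fin (m + 1) → ℝ) (i : Fin m) :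
    hitsBefore T x i.castSucc = hitsBefore T (Fin.init x) i := by
  unfold hitsBefore
  simp only [Finset.card_filter, Fin.sum_univ_castSucc, Fin.castSucc_lt_castSucc_iff,
    (Fin.castSucc_lt_last i).not_gt, false_and, if_false, add_zero]
  rfl

lemma hitsBefore_last {m : ℕ} (T : ℝ) (x : Fin (m + 1) → ℝ) :
    hitsBefore T x (Fin.last m) = hits T (Fin.init x) := by
  unfold hitsBefore hits
  simp only [Finset.card_filter, Fin.sum_univ_castSucc, Fin.castSucc_lt_last, lt_irrefl,
    true_and, false_and, if_false, add_zero]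
  rfl

lemma hits_succ {m : ℕ} (T : ℝ) (x : Fin (m + 1) → ℝ) :
    hits T x = hits T (Fin.init x) + if T ≤ x (Fin.last m) then 1 else 0 := by
  unfold hits
  simp only [Finset.card_filter, Fin.sum_univ_castSucc]
  rfl

lemma sum_accepted_eq_min {m : ℕ} (k : ℕ) (T : ℝ) (x : Fin m → ℝ) :
    ∑ i, (if T ≤ x i ∧ hitsBefore T x i < k then 1 else 0) = min (hits T x) k := by
  induction m with
  | zero => simp [hits]
  | succ m ih =>
    have h := ih (Fin.init x)
    rw [Fin.sum_univ_castSucc, hitsBefore_last, hits_succ]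
    simp_rw [hitsBefore_castSucc]
    have h' : ∑ i : Fin m, (if T ≤ x i.castSucc ∧ hitsBefore T (Fin.init x) i < k then 1 else 0)
        = min (hits T (Fin.init x)) k := h
    rw [h']
    split_ifs <;> grind

/-- Wald's identity for the number of accepted values. -/
lemma measure_Ici_mul_expectedOpen (m k : ℕ) (μ : Measure ℝ) [IsProbabilityMeasure μ] (T : ℝ) :
    μ (Set.Ici T) * expectedOpen m k μ T =
      ∫⁻ x : Fin m → ℝ, (min (hits T x) k : ℕ) ∂(Measure.pi fun _ => μ) := by
  have h := lintegral_sum_accepted m k μ T (f := fun _ => 1) measurable_const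
  rw [setLIntegral_one] at h
  rw [← h]
  refine lintegral_congr fun x => ?_
  rw [← sum_accepted_eq_min]
  push_cast
  rfl

lemma le_measure_Ici_mul_expectedOpen (m k : ℕ) (μ : Measure ℝ) [IsProbabilityMeasure μ] (T : ℝ) :
    k * (Measure.pi fun _ => μ) {x : Fin m → ℝ | k ≤ hits T x} ≤
      μ (Set.Ici T) * expectedOpen m k μ T := by
  rw [measure_Ici_mul_expectedOpen, ← lintegral_indicator_const
    (measurableSet_le measurable_const (measurable_hits T))]
  refine lintegral_mono fun x => ?_
  by_cases h : k ≤ hits T x <;> simp [h]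

lemma measure_Ici_mul_expectedOpen_le (m k : ℕ) (μ : Measure ℝ) [IsProbabilityMeasure μ] (T : ℝ) :
    μ (Set.Ici T) * expectedOpen m k μ T ≤
      k * (Measure.pi fun _ => μ) {x : Fin m → ℝ | 1 ≤ hits T x} := by
  rw [measure_Ici_mul_expectedOpen, ← lintegral_indicator_const
    (measurableSet_le measurable_const (measurable_hits T))]
  refine lintegral_mono fun x => ?_
  by_cases h : 1 ≤ hits T x
  · simp [h]
  · have : hits T x = 0 := by omega
    simp [this]

lemma one_le_expectedOpen {m k : ℕ} (hm : 0 < m) (hk : 0 < k) (μ : Measure ℝ)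
    [IsProbabilityMeasure μ] (T : ℝ) : 1 ≤ expectedOpen m k μ T := by
  unfold expectedOpen
  refine le_trans ?_ (Finset.single_le_sum (f := fun i : Fin m =>
    (Measure.pi fun _ => μ) {x : Fin m → ℝ | hitsBefore T x i < k}) (fun _ _ => zero_le)
    (Finset.mem_univ ⟨0, hm⟩))
  have : {x : Fin m → ℝ | hitsBefore T x ⟨0, hm⟩ < k} = Set.univ := by
    ext x
    simp [hitsBefore, Fin.lt_def, hk]
  simp [this]

/-- Every additional sample can only help a threshold algorithm. -/
lemma algValue_le_succ (m k : ℕ) (μ : Measure ℝ) [IsProbabilityMeasure μ] {T : ℝ} (hT : 0 ≤ T) :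
    algValue m k μ T ≤ algValue (m + 1) k μ T := by
  have hmp := measurePreserving_snd.comp
    (measurePreserving_piFinSuccAbove (fun _ : Fin (m + 1) => μ) (Fin.last m))
  have hmeas : Measurable fun x : Fin m → ℝ => ENNReal.ofReal (thresholdReward k T x) := by
    simp_rw [ofReal_thresholdReward k hT]
    refine Finset.measurable_sum _ fun i _ => Measurable.ite ?_ ?_ measurable_const
    · exact (measurableSet_le measurable_const (measurable_pi_apply i)).inter
        (measurableSet_lt (measurable_hitsBefore T i) measurable_const)
    · exact ENNReal.measurable_ofReal.comp (measurable_pi_apply i)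
  unfold algValue
  rw [← hmp.lintegral_comp hmeas]
  refine lintegral_mono fun x => ?_
  have hinit : (Prod.snd ∘ (MeasurableEquiv.piFinSuccAbove (fun _ => ℝ) (Fin.last m))) x
      = Fin.init x := by
    funext i
    simp [MeasurableEquiv.piFinSuccAbove, Fin.insertNthEquiv, Fin.init]
  simp only [hinit]
  rw [ofReal_thresholdReward k hT, ofReal_thresholdReward k hT, Fin.sum_univ_castSucc]
  simp_rw [hitsBefore_castSucc]
  exact le_self_add

lemma competitiveRatio_mono {m m' : ℕ} (h : m ≤ m') (n k : ℕ) :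
    competitiveRatio m n k ≤ competitiveRatio m' n k := by
  refine monotone_nat_of_le_succ (f := fun m => competitiveRatio m n k) (fun m => ?_) h
  refine iInf₂_mono fun μ hμ => iSup₂_mono fun q _ => iSup₂_mono fun T hT => ?_
  have := hμ.1
  exact ENNReal.div_le_div_right (algValue_le_succ m k μ hT.1) _

/-! ### The number of samples above the threshold -/

lemma measure_one_le_hits (m : ℕ) (μ : Measure ℝ) [IsProbabilityMeasure μ] (T : ℝ) :
    (Measure.pi fun _ => μ) {x : Fin m → ℝ | 1 ≤ hits T x} =
      ENNReal.ofReal (1 - (1 - μ.real (Set.Ici T)) ^ m) := by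
  have hset : {x : Fin m → ℝ | 1 ≤ hits T x} = (Set.univ.pi fun _ => Set.Iio T)ᶜ := by
    ext x
    simp [hits, Nat.one_le_iff_ne_zero, Finset.filter_eq_empty_iff]
  have hIio : μ.real (Set.Iio T) = 1 - μ.real (Set.Ici T) := by
    rw [← Set.compl_Ici, probReal_compl_eq_one_sub measurableSet_Ici]
  rw [hset, ← ofReal_measureReal, probReal_compl_eq_one_sub
    (MeasurableSet.univ_pi fun _ => measurableSet_Iio), ← hIio]
  congr 2
  simp [Measure.real, Measure.pi_pi]

/-- The moment generating function of the binomially distributed number of hits. -/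
lemma lintegral_pow_hits (m : ℕ) (μ : Measure ℝ) [IsProbabilityMeasure μ] (T : ℝ) {w : ℝ}
    (hw : 0 ≤ w) :
    ∫⁻ x : Fin m → ℝ, ENNReal.ofReal (w ^ hits T x) ∂(Measure.pi fun _ => μ) =
      ENNReal.ofReal ((1 - μ.real (Set.Ici T) * (1 - w)) ^ m) := by
  have hg : Measurable fun t : ℝ => if T ≤ t then ENNReal.ofReal w else 1 :=
    Measurable.ite measurableSet_Ici measurable_const measurable_const
  have hprod : ∀ x : Fin m → ℝ, ENNReal.ofReal (w ^ hits T x) =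
      ∏ i, (if T ≤ x i then ENNReal.ofReal w else 1) := by
    intro x
    rw [Finset.prod_ite, Finset.prod_const_one, mul_one, Finset.prod_const, hits,
      ENNReal.ofReal_pow hw]
  have hind : iIndepFun (fun (i : Fin m) (x : Fin m → ℝ) =>
      if T ≤ x i then ENNReal.ofReal w else 1) (Measure.pi fun _ => μ) :=
    iIndepFun_pi (μ := fun _ : Fin m => μ)
      (X := fun _ (t : ℝ) => if T ≤ t then ENNReal.ofReal w else 1) fun _ => hg.aemeasurable
  simp_rw [hprod]
  have hone : ∀ i : Fin m, ∫⁻ x : Fin m → ℝ, (if T ≤ x i then ENNReal.ofReal w else 1)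
      ∂(Measure.pi fun _ => μ) = ENNReal.ofReal (1 - μ.real (Set.Ici T) * (1 - w)) := by
    intro i
    have h1 := (measurePreserving_eval (fun _ : Fin m => μ) i).lintegral_comp hg
    have h2 : ∫⁻ t, (if T ≤ t then ENNReal.ofReal w else 1) ∂μ =
        ENNReal.ofReal w * μ (Set.Ici T) + μ (Set.Iio T) := by
      rw [← lintegral_add_compl _ (measurableSet_Ici (a := T)), Set.compl_Ici]
      congr 1
      · rw [setLIntegral_congr_fun measurableSet_Ici (g := fun _ => ENNReal.ofReal w)
          (fun t (ht : T ≤ t) => if_pos ht), setLIntegral_const]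
      · rw [setLIntegral_congr_fun measurableSet_Iio (g := fun _ => 1)
          (fun t (ht : t < T) => if_neg (not_le.2 ht)), setLIntegral_one]
    have hIio : μ.real (Set.Iio T) = 1 - μ.real (Set.Ici T) := by
      rw [← Set.compl_Ici, probReal_compl_eq_one_sub measurableSet_Ici]
    refine h1.trans ?_
    rw [h2, ← ofReal_measureReal (s := Set.Ici T), ← ofReal_measureReal (s := Set.Iio T), hIio,
      ← ENNReal.ofReal_mul hw, ← ENNReal.ofReal_add (by positivity)
      (sub_nonneg.2 measureReal_le_one)]
    congr 1
    ring
  rw [lintegral_prod_eq_prod_lintegral_of_indepFun _ _ hind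
    fun i => hg.comp (measurable_pi_apply i)]
  simp_rw [hone]
  have hq := measureReal_le_one (μ := μ) (s := Set.Ici T)
  have hq0 : 0 ≤ μ.real (Set.Ici T) := measureReal_nonneg
  rw [Finset.prod_const, Finset.card_univ, Fintype.card_fin, ENNReal.ofReal_pow]
  nlinarith [mul_nonneg hq0 hw]

/-- A Chernoff bound for the lower tail of the number of hits. Here `a * r` is a lower bound for
the expected number of hits, and the exponential tilt is `1 / a`. -/
lemma measure_hits_lt_le (m k : ℕ) (hk : 1 ≤ k) (μ : Measure ℝ) [IsProbabilityMeasure μ] (T : ℝ)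
    {a r : ℝ} (ha : 1 ≤ a) (hr : (k : ℝ) - 1 ≤ r) (hm : a * r ≤ m * μ.real (Set.Ici T)) :
    (Measure.pi fun _ => μ) {x : Fin m → ℝ | hits T x < k} ≤
      ENNReal.ofReal (Real.exp (-(r * (a - 1 - Real.log a)))) := by
  have ha0 : 0 < a := by linarith
  have hw : 0 < a⁻¹ := inv_pos.2 ha0
  have hw1 : a⁻¹ ≤ 1 := inv_le_one_of_one_le₀ ha
  have hwk : ENNReal.ofReal (a⁻¹ ^ (k - 1)) ≠ 0 := by
    simpa using pow_pos ha0 _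
  have hmarkov : ENNReal.ofReal (a⁻¹ ^ (k - 1)) *
      (Measure.pi fun _ => μ) {x : Fin m → ℝ | hits T x < k} ≤
      ENNReal.ofReal ((1 - μ.real (Set.Ici T) * (1 - a⁻¹)) ^ m) := by
    rw [← lintegral_pow_hits m μ T hw.le, ← lintegral_indicator_const
      (measurableSet_lt (measurable_hits T) measurable_const)]
    refine lintegral_mono fun x => ?_
    by_cases h : hits T x < k
    · simp only [Set.indicator, Set.mem_ofPred_eq, h, if_true]
      exact ENNReal.ofReal_le_ofReal (pow_le_pow_of_le_one hw.le hw1 (by omega))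
    · simp [h]
  rw [mul_comm, ← ENNReal.le_div_iff_mul_le (Or.inl hwk) (Or.inl ENNReal.ofReal_ne_top),
    ← ENNReal.ofReal_div_of_pos (by positivity)] at hmarkov
  refine hmarkov.trans (ENNReal.ofReal_le_ofReal ?_)
  have hq := measureReal_le_one (μ := μ) (s := Set.Ici T)
  have hq0 : 0 ≤ μ.real (Set.Ici T) := measureReal_nonneg
  have h1 : (1 - μ.real (Set.Ici T) * (1 - a⁻¹)) ^ m ≤ Real.exp (-(r * (a - 1))) := by
    calc (1 - μ.real (Set.Ici T) * (1 - a⁻¹)) ^ m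
        ≤ Real.exp (-(μ.real (Set.Ici T) * (1 - a⁻¹))) ^ m :=
          pow_le_pow_left₀ (by nlinarith) (Real.one_sub_le_exp_neg _) _
      _ = Real.exp (-(m * μ.real (Set.Ici T) * (1 - a⁻¹))) := by
          rw [← Real.exp_nat_mul]; congr 1; ring
      _ ≤ Real.exp (-(a * r * (1 - a⁻¹))) :=
          Real.exp_le_exp.2 (neg_le_neg (mul_le_mul_of_nonneg_right hm (by linarith)))
      _ = Real.exp (-(r * (a - 1))) := by congr 1; field_simp
  have h2 : Real.exp (-(r * Real.log a)) ≤ a⁻¹ ^ (k - 1) := by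
    rw [← Real.exp_log hw, ← Real.exp_nat_mul, Real.log_inv, Nat.cast_sub hk, Nat.cast_one]
    exact Real.exp_le_exp.2 (by nlinarith [Real.log_nonneg ha])
  rw [div_le_iff₀ (by positivity)]
  calc _ ≤ _ := h1
    _ = Real.exp (-(r * (a - 1 - Real.log a))) * Real.exp (-(r * Real.log a)) := by
      rw [← Real.exp_add]; congr 1; ring
    _ ≤ _ := mul_le_mul_of_nonneg_left h2 (Real.exp_nonneg _)

/-! ### Lower bounds on the competitive ratio -/

lemma lintegral_finset_sum_ge {α ι : Type*} [MeasurableSpace α] (μ : Measure α) (s : Finset ι)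
    (f : ι → α → ℝ≥0∞) : ∑ i ∈ s, ∫⁻ x, f i x ∂μ ≤ ∫⁻ x, ∑ i ∈ s, f i x ∂μ := by
  classical
  induction s using Finset.induction_on with
  | empty => simp
  | insert i s hi ih =>
    simp_rw [Finset.sum_insert hi]
    exact (add_le_add_right ih _).trans (le_lintegral_add _ _)

lemma card_filter_val_lt {n k : ℕ} (hkn : k ≤ n) :
    (Finset.univ.filter fun i : Fin n => (i : ℕ) < k).card = k := by
  simp [Fin.card_filter_val_lt, hkn]

/-- The ex-ante bound: each of the `k` collected values is at most `T` plus its excess over `T`. -/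
lemma prophetValue_le {n k : ℕ} (hkn : k ≤ n) (μ : Measure ℝ) [IsProbabilityMeasure μ] (T : ℝ) :
    prophetValue n k μ ≤
      k * ENNReal.ofReal T + n * ∫⁻ t, ENNReal.ofReal (t - T) ∂μ := by
  have hmeas : Measurable fun t : ℝ => ENNReal.ofReal (t - T) := by fun_prop
  have hpt : ∀ x : Fin n → ℝ,
      ∑ i ∈ Finset.univ.filter (fun i : Fin n => (i : ℕ) < k), ENNReal.ofReal (orderStat x i) ≤
        k * ENNReal.ofReal T + ∑ i, ENNReal.ofReal (x i - T) := by
    intro x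
    calc _ ≤ ∑ i ∈ Finset.univ.filter (fun i : Fin n => (i : ℕ) < k),
          (ENNReal.ofReal T + ENNReal.ofReal (orderStat x i - T)) := by
            refine Finset.sum_le_sum fun i _ => ?_
            refine le_trans (ENNReal.ofReal_le_ofReal ?_) ENNReal.ofReal_add_le
            linarith
      _ = k * ENNReal.ofReal T + ∑ i ∈ Finset.univ.filter (fun i : Fin n => (i : ℕ) < k),
          ENNReal.ofReal (orderStat x i - T) := by
            rw [Finset.sum_add_distrib, Finset.sum_const, card_filter_val_lt hkn, nsmul_eq_mul]
      _ ≤ k * ENNReal.ofReal T + ∑ i, ENNReal.ofReal (orderStat x i - T) := by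
            gcongr
            exact Finset.filter_subset _ _
      _ = _ := by
            congr 1
            exact Equiv.sum_comp (Fin.revPerm.trans (Tuple.sort x))
              (fun i => ENNReal.ofReal (x i - T))
  unfold prophetValue
  refine (lintegral_finset_sum_ge _ _ _).trans ((lintegral_mono hpt).trans ?_)
  rw [lintegral_add_left measurable_const, lintegral_const, measure_univ, mul_one,
    lintegral_finsetSum _ fun i _ => by fun_prop]
  have hone : ∀ i : Fin n, ∫⁻ x : Fin n → ℝ, ENNReal.ofReal (x i - T) ∂(Measure.pi fun _ => μ) =
      ∫⁻ t, ENNReal.ofReal (t - T) ∂μ := fun i =>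
    (measurePreserving_eval (fun _ : Fin n => μ) i).lintegral_comp hmeas
  simp_rw [hone]
  simp

lemma setLIntegral_Ici_eq (μ : Measure ℝ) {T : ℝ} (hT : 0 ≤ T) :
    ∫⁻ t in Set.Ici T, ENNReal.ofReal t ∂μ =
      ENNReal.ofReal T * μ (Set.Ici T) + ∫⁻ t, ENNReal.ofReal (t - T) ∂μ := by
  have h1 : ∫⁻ t in Set.Ici T, ENNReal.ofReal t ∂μ =
      ∫⁻ t in Set.Ici T, (ENNReal.ofReal T + ENNReal.ofReal (t - T)) ∂μ := by
    refine setLIntegral_congr_fun measurableSet_Ici fun t ht => ?_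
    rw [← ENNReal.ofReal_add hT (sub_nonneg.2 ht)]
    congr 1
    ring
  have h2 : ∫⁻ t in Set.Ici T, ENNReal.ofReal (t - T) ∂μ = ∫⁻ t, ENNReal.ofReal (t - T) ∂μ := by
    refine setLIntegral_eq_of_support_subset ?_
    intro t ht
    simp only [Function.mem_support, ne_eq, ENNReal.ofReal_eq_zero, not_le] at ht
    simp only [Set.mem_Ici]
    linarith
  rw [h1, lintegral_add_left measurable_const, setLIntegral_const, h2]

lemma prophetValue_ne_top {n k : ℕ} (hkn : k ≤ n) {μ : Measure ℝ}
    (hμ : μ ∈ continuousDistributions) : prophetValue n k μ ≠ ⊤ := by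
  have := hμ.1
  refine ne_top_of_le_ne_top ?_ (prophetValue_le hkn μ 0)
  simpa using ENNReal.mul_ne_top (ENNReal.natCast_ne_top n) hμ.2.2.2

lemma cdf_eq_one_sub (μ : Measure ℝ) [IsProbabilityMeasure μ] [NullSingletonClass μ] (T : ℝ) :
    cdf μ T = 1 - μ.real (Set.Ici T) := by
  rw [cdf_eq_real, ← probReal_compl_eq_one_sub measurableSet_Ici, Set.compl_Ici]
  exact (measureReal_congr Iio_ae_eq_Iic).symm

/-- A continuous distribution has a nonnegative threshold at every positive quantile. -/
lemma exists_threshold {μ : Measure ℝ} (hμ : μ ∈ continuousDistributions) {q : ℝ} (hq : 0 < q)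
    (hq1 : q ≤ 1) : ∃ T, 0 ≤ T ∧ μ.real (Set.Ici T) = q := by
  obtain ⟨hprob, hatom, hneg, -⟩ := hμ
  have hcont : Continuous (cdf μ) := by
    rw [continuous_iff_continuousAt]
    intro x
    rw [(monotone_cdf μ).continuousAt_iff_leftLim_eq_rightLim, (cdf μ).rightLim_eq]
    have h := (cdf μ).measure_singleton x
    rw [measure_cdf, measure_singleton] at h
    have h1 := ENNReal.ofReal_eq_zero.1 h.symm
    exact le_antisymm ((monotone_cdf μ).leftLim_le le_rfl) (by linarith)
  have h0 : cdf μ 0 = 0 := by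
    rw [cdf_eq_real, ← measureReal_congr Iio_ae_eq_Iic]
    simp [Measure.real, hneg]
  have hlim := tendsto_cdf_atTop μ
  obtain ⟨b, hb, hb0⟩ := ((hlim.eventually (lt_mem_nhds (show 1 - q < 1 by linarith))).and
    (Filter.eventually_ge_atTop 0)).exists
  obtain ⟨T, hT, hTq⟩ := intermediate_value_Icc hb0 hcont.continuousOn
    (show 1 - q ∈ Set.Icc (cdf μ 0) (cdf μ b) from ⟨by rw [h0]; linarith, hb.le⟩)
  refine ⟨T, hT.1, ?_⟩
  rw [cdf_eq_one_sub] at hTq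
  linarith

/-- At the quantile `k / n`, the threshold algorithm loses only when it fails to accept `k`
values. -/
lemma measure_mul_prophetValue_le {m n k : ℕ} (hk : 1 ≤ k) (hkn : k ≤ n) (μ : Measure ℝ)
    [IsProbabilityMeasure μ] {T : ℝ} (hT : 0 ≤ T) (hq : μ.real (Set.Ici T) = (k : ℝ) / n) :
    (Measure.pi fun _ => μ) {x : Fin m → ℝ | k ≤ hits T x} * prophetValue n k μ ≤
      algValue m k μ T := by
  set P := (Measure.pi fun _ => μ) {x : Fin m → ℝ | k ≤ hits T x}
  have hk0 : (k : ℝ≥0∞) ≠ 0 := by simp; omega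
  have hn0 : (0 : ℝ) < n := by exact_mod_cast (by omega : 0 < n)
  have hnq : (n : ℝ≥0∞) * μ (Set.Ici T) = k := by
    rw [← ofReal_measureReal, hq, ← ENNReal.ofReal_natCast n, ← ENNReal.ofReal_mul hn0.le,
      mul_div_cancel₀ _ hn0.ne', ENNReal.ofReal_natCast]
  have hS : (n : ℝ≥0∞) * P ≤ expectedOpen m k μ T := by
    have h := mul_le_mul_right (le_measure_Ici_mul_expectedOpen m k μ T) (n : ℝ≥0∞)
    rw [← mul_assoc _ (μ _), hnq, ← mul_assoc, mul_comm (n : ℝ≥0∞), mul_assoc] at h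
    exact (ENNReal.mul_le_mul_iff_right hk0 (ENNReal.natCast_ne_top k)).1 h
  rw [algValue_eq m k μ hT, setLIntegral_Ici_eq μ hT]
  calc P * prophetValue n k μ
      ≤ P * (k * ENNReal.ofReal T + n * ∫⁻ t, ENNReal.ofReal (t - T) ∂μ) := by
        gcongr; exact prophetValue_le hkn μ T
    _ = (ENNReal.ofReal T * μ (Set.Ici T) + ∫⁻ t, ENNReal.ofReal (t - T) ∂μ) * (n * P) := by
        rw [← hnq]; ring
    _ ≤ _ := by gcongr

lemma le_competitiveRatio {m n k : ℕ} (hm : 0 < m) (hk : 1 ≤ k) (hkn : k ≤ n) {c : ℝ≥0∞}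
    (hc : ∀ (μ : Measure ℝ) (T : ℝ), IsProbabilityMeasure μ → μ.real (Set.Ici T) = (k : ℝ) / n →
      c ≤ (Measure.pi fun _ => μ) {x : Fin m → ℝ | k ≤ hits T x}) :
    c ≤ competitiveRatio m n k := by
  refine le_iInf₂ fun μ hμ => ?_
  have hprob := hμ.1
  have hatom := hμ.2.1
  have hn0 : (0 : ℝ) < n := by exact_mod_cast (by omega : 0 < n)
  have hk0 : (0 : ℝ) < k := by exact_mod_cast hk
  have hq0 : (0 : ℝ) < k / n := by positivity
  have hq1 : (k : ℝ) / n ≤ 1 := (div_le_one hn0).2 (by exact_mod_cast hkn)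
  obtain ⟨T, hT, hTq⟩ := exists_threshold hμ hq0 hq1
  refine le_trans ?_ (le_iSup₂_of_le ((k : ℝ) / n) ⟨hq0.le, hq1⟩
    (le_iSup₂_of_le T ⟨hT, by rw [cdf_eq_one_sub, hTq]⟩ le_rfl))
  have hALG : algValue m k μ T ≠ 0 := by
    rw [algValue_eq m k μ hT]
    refine mul_ne_zero ?_ (zero_lt_one.trans_le (one_le_expectedOpen hm hk μ T)).ne'
    have hne : μ (Set.Ioi T) ≠ 0 := by
      rw [measure_congr Ioi_ae_eq_Ici]
      intro h
      rw [Measure.real, h, ENNReal.toReal_zero] at hTq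
      exact hq0.ne hTq
    intro h
    rw [lintegral_eq_zero_iff ENNReal.measurable_ofReal] at h
    apply hne
    have h' := (ae_restrict_iff' measurableSet_Ici).1 h
    refine measure_mono_null ?_ h'
    intro t ht hcon
    have h2 := hcon (Set.mem_Ici.2 (le_of_lt ht))
    simp only [Pi.zero_apply, ENNReal.ofReal_eq_zero] at h2
    exact absurd (Set.mem_Ioi.1 ht) (by linarith)
  rw [ENNReal.le_div_iff_mul_le (Or.inr hALG) (Or.inl (prophetValue_ne_top hkn hμ))]
  exact (mul_le_mul_left (hc μ T hprob hTq) _).trans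
    (measure_mul_prophetValue_le hk hkn μ hT hTq)

/-- For a single accepted value the number of hits at quantile `1 / n` is positive with
probability `1 - (1 - 1 / n) ^ m`. -/
lemma le_competitiveRatio_one {m n : ℕ} (hm : 0 < m) (hn : 1 ≤ n) :
    ENNReal.ofReal (1 - (1 - 1 / (n : ℝ)) ^ m) ≤ competitiveRatio m n 1 := by
  refine le_competitiveRatio hm le_rfl hn fun μ T _ hq => ?_
  rw [measure_one_le_hits, hq, Nat.cast_one]

lemma le_competitiveRatio_chernoff {m n k : ℕ} (hm : 0 < m) (hk : 1 ≤ k) (hkn : k ≤ n)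
    {a r : ℝ} (ha : 1 ≤ a) (hr : (k : ℝ) - 1 ≤ r) (hmn : a * r * n ≤ m * k) :
    ENNReal.ofReal (1 - Real.exp (-(r * (a - 1 - Real.log a)))) ≤ competitiveRatio m n k := by
  refine le_competitiveRatio hm hk hkn fun μ T _ hq => ?_
  have hn0 : (0 : ℝ) < n := by exact_mod_cast (by omega : 0 < n)
  have h := measure_hits_lt_le m k hk μ T ha hr (by
    rw [hq, ← mul_div_assoc, le_div_iff₀ hn0]; exact hmn)
  have hcompl : {x : Fin m → ℝ | k ≤ hits T x} = {x : Fin m → ℝ | hits T x < k}ᶜ := by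
    ext x; simp
  rw [hcompl, prob_compl_eq_one_sub (measurableSet_lt (measurable_hits T) measurable_const),
    ENNReal.ofReal_sub _ (Real.exp_nonneg _), ENNReal.ofReal_one]
  exact tsub_le_tsub_left h 1

/-! ### The tangent inequality -/

/-- The weighted AM-GM inequality for the numbers `t ^ m` and `1`. -/
lemma natCast_mul_pow_le {j m : ℕ} (hj : j ≤ m) {t : ℝ} (ht : 0 ≤ t) :
    m * t ^ j ≤ j * t ^ m + (m - j) := by
  rcases Nat.eq_zero_or_pos m with rfl | hm
  · obtain rfl : j = 0 := by omega
    simp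
  have hm0 : (0 : ℝ) < m := by exact_mod_cast hm
  have hjm : (j : ℝ) ≤ m := by exact_mod_cast hj
  have h := Real.geom_mean_le_arith_mean2_weighted (w₁ := (j : ℝ) / m) (w₂ := (m - j) / m)
    (p₁ := t ^ m) (p₂ := 1) (by positivity) (div_nonneg (by linarith) hm0.le) (by positivity)
    zero_le_one (by field_simp; ring)
  rw [Real.one_rpow, mul_one, ← Real.rpow_natCast, ← Real.rpow_mul ht,
    mul_div_cancel₀ _ hm0.ne', Real.rpow_natCast, Real.rpow_natCast] at h
  have h2 := mul_le_mul_of_nonneg_left h hm0.le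
  calc m * t ^ j ≤ _ := h2
    _ = _ := by field_simp

lemma pow_sub_pow_comparison {j m : ℕ} (hj : j ≤ m) {x y : ℝ} (hx : 0 ≤ x) (hy : 0 < y) :
    j * y ^ (j - 1) * (y ^ m - x ^ m) ≤ m * y ^ (m - 1) * (y ^ j - x ^ j) := by
  rcases Nat.eq_zero_or_pos j with rfl | hj0
  · simp
  obtain ⟨i, rfl⟩ : ∃ i, j = i + 1 := ⟨j - 1, by omega⟩
  obtain ⟨l, rfl⟩ : ∃ l, m = l + 1 := ⟨m - 1, by omega⟩
  obtain ⟨t, ht, rfl⟩ : ∃ t, 0 ≤ t ∧ x = t * y := ⟨x / y, by positivity, by field_simp⟩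
  have h := mul_le_mul_of_nonneg_left (natCast_mul_pow_le hj ht)
    (by positivity : 0 ≤ y ^ (i + l + 1))
  simp only [Nat.add_sub_cancel]
  rw [mul_pow, mul_pow]
  have e1 : y ^ (i + l + 1) = y ^ i * y ^ (l + 1) := by ring
  have e2 : y ^ (i + l + 1) = y ^ l * y ^ (i + 1) := by ring
  have e3 : ((i + 1 : ℕ) : ℝ) * y ^ i * (y ^ (l + 1) - t ^ (l + 1) * y ^ (l + 1)) =
      y ^ (i + l + 1) * ((i + 1 : ℕ) * (1 - t ^ (l + 1))) := by rw [e1]; ring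
  have e4 : ((l + 1 : ℕ) : ℝ) * y ^ l * (y ^ (i + 1) - t ^ (i + 1) * y ^ (i + 1)) =
      y ^ (i + l + 1) * ((l + 1 : ℕ) * (1 - t ^ (i + 1))) := by rw [e2]; ring
  rw [e3, e4]
  nlinarith

/-- The function `q ↦ q / (1 - (1 - q) ^ m)`, whose reciprocal is the geometric sum, lies above its
tangent line at `q₀`; up to scaling this line is `q ↦ q + A`. -/
lemma exists_tangent {m : ℕ} (hm : 2 ≤ m) {q₀ : ℝ} (hq₀ : q₀ < 1) :
    ∃ A : ℝ, 0 < A ∧ ∀ q : ℝ, q ≤ 1 →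
      (q + A) * ∑ j ∈ Finset.range m, (1 - q) ^ j ≤
        (q₀ + A) * ∑ j ∈ Finset.range m, (1 - q₀) ^ j := by
  have hy : 0 < 1 - q₀ := by linarith
  set y := 1 - q₀ with hydef
  set D := ∑ j ∈ Finset.range m, (j : ℝ) * y ^ (j - 1) with hD
  have hDpos : 0 < D := by
    refine Finset.sum_pos' (fun j _ => by positivity) ⟨1, by simp; omega, by simp⟩
  have hm0 : (0 : ℝ) < m := by exact_mod_cast (by omega : 0 < m)
  refine ⟨m * y ^ (m - 1) / D, by positivity, fun q hq => ?_⟩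
  set x := 1 - q with hxdef
  have hx : 0 ≤ x := by linarith
  have hsum : D * (y ^ m - x ^ m) ≤ m * y ^ (m - 1) *
      (∑ j ∈ Finset.range m, y ^ j - ∑ j ∈ Finset.range m, x ^ j) := by
    rw [← Finset.sum_sub_distrib, hD, Finset.sum_mul, Finset.mul_sum]
    exact Finset.sum_le_sum fun j hj =>
      pow_sub_pow_comparison (Finset.mem_range.1 hj).le hx hy
  have gx : q * ∑ j ∈ Finset.range m, x ^ j = 1 - x ^ m := by
    have := mul_neg_geom_sum x m
    rw [hxdef] at this ⊢
    linarith
  have gy : q₀ * ∑ j ∈ Finset.range m, y ^ j = 1 - y ^ m := by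
    have := mul_neg_geom_sum y m
    rw [hydef] at this ⊢
    linarith
  rw [add_mul, add_mul, gx, gy]
  have h2 : y ^ m - x ^ m ≤ m * y ^ (m - 1) / D *
      (∑ j ∈ Finset.range m, y ^ j - ∑ j ∈ Finset.range m, x ^ j) := by
    rw [div_mul_eq_mul_div, le_div_iff₀ hDpos]
    linarith
  linarith

/-! ### The hard instance and upper bounds on the competitive ratio -/

/-- The support of the hard instance: values between `B` and `B + 1`, and, with probability
`B⁻¹`, values near `B + B ^ 2 * A`. -/
def hardSupport (A B : ℝ) : Set ℝ :=
  Set.Icc B (B + 1 - B⁻¹) ∪ Set.Icc (B + B ^ 2 * A) (B + B ^ 2 * A + B⁻¹)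

/-- The hard instance: the uniform distribution on `hardSupport A B`, which has length `1`. After
division by `B` it is close, for large `B`, to the constant `1` plus a rare value of expectation
`A`. -/
noncomputable def hardInstance (A B : ℝ) : Measure ℝ :=
  volume.restrict (hardSupport A B)

section HardInstance

variable {A B : ℝ}

lemma measurableSet_hardSupport : MeasurableSet (hardSupport A B) :=
  measurableSet_Icc.union measurableSet_Icc

lemma le_of_mem_hardSupport (hA : 0 ≤ A) {t : ℝ} (ht : t ∈ hardSupport A B) : B ≤ t := by
  rcases ht with h | h
  · exact h.1
  · exact le_trans (le_add_of_nonneg_right (by positivity)) h.1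

lemma isProbabilityMeasure_hardInstance (hB : 1 ≤ B) (hAB : 1 ≤ B ^ 2 * A) :
    IsProbabilityMeasure (hardInstance A B) := by
  have hB0 : 0 < B⁻¹ := inv_pos.2 (by linarith)
  have hB1 : B⁻¹ ≤ 1 := inv_le_one_of_one_le₀ hB
  refine ⟨?_⟩
  rw [hardInstance, Measure.restrict_apply_univ, hardSupport, measure_union _ measurableSet_Icc,
    Real.volume_Icc, Real.volume_Icc, ← ENNReal.ofReal_add (by linarith) (by linarith)]
  · ring_nf
    simp
  · rw [Set.disjoint_left]
    intro t h1 h2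
    have := h1.2
    have := h2.1
    linarith

lemma hardInstance_mem (hB : 1 ≤ B) (hA : 0 ≤ A) (hAB : 1 ≤ B ^ 2 * A) :
    hardInstance A B ∈ continuousDistributions := by
  have hp := isProbabilityMeasure_hardInstance hB hAB
  have hB0 : 0 < B⁻¹ := inv_pos.2 (by linarith)
  refine ⟨hp, by unfold hardInstance; infer_instance, ?_, ?_⟩
  · rw [hardInstance, Measure.restrict_apply measurableSet_Iio]
    have hempty : Set.Iio 0 ∩ hardSupport A B = ∅ := by
      ext t
      simp only [Set.mem_inter_iff, Set.mem_Iio, Set.mem_empty_iff_false, iff_false, not_and]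
      intro h1 h2
      linarith [le_of_mem_hardSupport hA h2]
    rw [hempty, measure_empty]
  · refine ne_top_of_le_ne_top (b := ENNReal.ofReal (B + 1 + B ^ 2 * A + B⁻¹)) (by simp) ?_
    have : ∫⁻ t, ENNReal.ofReal t ∂(hardInstance A B) ≤
        ∫⁻ _, ENNReal.ofReal (B + 1 + B ^ 2 * A + B⁻¹) ∂(hardInstance A B) := by
      refine setLIntegral_mono' measurableSet_hardSupport fun t ht =>
        ENNReal.ofReal_le_ofReal ?_
      rcases ht with h | h <;> linarith [h.2]
    simpa using this

lemma hardInstance_Ici (hB : 1 ≤ B) (hAB : 1 ≤ B ^ 2 * A) :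
    hardInstance A B (Set.Ici (B + B ^ 2 * A)) = ENNReal.ofReal B⁻¹ := by
  have hB0 : 0 < B⁻¹ := inv_pos.2 (by linarith)
  have hset : Set.Ici (B + B ^ 2 * A) ∩ hardSupport A B =
      Set.Icc (B + B ^ 2 * A) (B + B ^ 2 * A + B⁻¹) := by
    ext t
    simp only [hardSupport, Set.mem_inter_iff, Set.mem_Ici, Set.mem_union, Set.mem_Icc]
    constructor
    · rintro ⟨h1, h2 | h2⟩
      · linarith [h2.2]
      · exact h2
    · intro h
      exact ⟨h.1, Or.inr h⟩
  rw [hardInstance, Measure.restrict_apply measurableSet_Ici, hset, Real.volume_Icc]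
  congr 1
  ring

lemma setLIntegral_hardInstance_le (hB : 1 ≤ B) (hA : 0 ≤ A) (hAB : 1 ≤ B ^ 2 * A) (T : ℝ) :
    ∫⁻ t in Set.Ici T, ENNReal.ofReal t ∂(hardInstance A B) ≤
      ENNReal.ofReal ((B + 1) * ((hardInstance A B).real (Set.Ici T) + A)) := by
  have hp := isProbabilityMeasure_hardInstance hB hAB
  have hB0 : 0 < B := by linarith
  have hB1 : B⁻¹ ≤ 1 := inv_le_one_of_one_le₀ hB
  have hae : ∀ᵐ t ∂(hardInstance A B), t ∈ hardSupport A B :=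
    ae_restrict_mem measurableSet_hardSupport
  calc ∫⁻ t in Set.Ici T, ENNReal.ofReal t ∂(hardInstance A B)
      ≤ ∫⁻ t in Set.Ici T, (ENNReal.ofReal (B + 1) +
          (Set.Ici (B + B ^ 2 * A)).indicator (fun _ => ENNReal.ofReal (B ^ 2 * A)) t)
          ∂(hardInstance A B) := by
        refine lintegral_mono_ae ((ae_restrict_of_ae hae).mono fun t ht => ?_)
        rcases ht with h | h
        · refine le_add_right (ENNReal.ofReal_le_ofReal ?_)
          have := inv_pos.2 hB0
          linarith [h.2]
        · rw [Set.indicator_of_mem (Set.mem_Ici.2 h.1),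
            ← ENNReal.ofReal_add (by linarith) (by linarith)]
          refine ENNReal.ofReal_le_ofReal ?_
          linarith [h.2]
    _ ≤ ENNReal.ofReal (B + 1) * (hardInstance A B) (Set.Ici T) +
          ENNReal.ofReal (B ^ 2 * A) * ENNReal.ofReal B⁻¹ := by
        rw [lintegral_add_left measurable_const, setLIntegral_const]
        gcongr
        refine (setLIntegral_le_lintegral _ _).trans ?_
        rw [lintegral_indicator_const measurableSet_Ici, hardInstance_Ici hB hAB]
    _ = ENNReal.ofReal ((B + 1) * (hardInstance A B).real (Set.Ici T) + B * A) := by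
        rw [← ofReal_measureReal, ← ENNReal.ofReal_mul (by linarith),
          ← ENNReal.ofReal_mul (by linarith), ← ENNReal.ofReal_add (by positivity) (by positivity)]
        congr 2
        field_simp
    _ ≤ _ := ENNReal.ofReal_le_ofReal (by nlinarith)

lemma le_orderStat_zero {n : ℕ} (x : Fin n → ℝ) {i : Fin n} (hi : (i : ℕ) = 0) (j : Fin n) :
    x j ≤ orderStat x i := by
  have h := Tuple.monotone_sort x (a := (Tuple.sort x).symm j) (b := i.rev) (by
    rw [Fin.le_def, Fin.val_rev, hi]
    omega)
  simpa [orderStat] using h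

/-- On the hard instance the prophet collects `k` values of at least `B`, and in addition the rare
high value whenever it appears. -/
lemma le_prophetValue_hardInstance {n k : ℕ} (hk : 1 ≤ k) (hkn : k ≤ n) (hB : 1 ≤ B) (hA : 0 ≤ A)
    (hAB : 1 ≤ B ^ 2 * A) :
    ENNReal.ofReal (B * (k + n * A) / (1 + n / B)) ≤ prophetValue n k (hardInstance A B) := by
  have hp := isProbabilityMeasure_hardInstance hB hAB
  have hB0 : 0 < B := by linarith
  have hB1 : B⁻¹ ≤ 1 := inv_le_one_of_one_le₀ hB
  have hn : 0 < n := by omega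
  have hae : ∀ᵐ x ∂(Measure.pi fun _ : Fin n => hardInstance A B), ∀ j, x j ∈ hardSupport A B := by
    rw [ae_all_iff]
    intro j
    exact (measurePreserving_eval (fun _ : Fin n => hardInstance A B) j).quasiMeasurePreserving.ae
      (ae_restrict_mem measurableSet_hardSupport)
  have hall : ∀ i : Fin n, ENNReal.ofReal B ≤
      ∫⁻ x : Fin n → ℝ, ENNReal.ofReal (orderStat x i) ∂(Measure.pi fun _ => hardInstance A B) := by
    intro i
    have : ∫⁻ _ : Fin n → ℝ, ENNReal.ofReal B ∂(Measure.pi fun _ => hardInstance A B) ≤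
        ∫⁻ x : Fin n → ℝ, ENNReal.ofReal (orderStat x i)
          ∂(Measure.pi fun _ => hardInstance A B) :=
      lintegral_mono_ae (hae.mono fun x hx =>
        ENNReal.ofReal_le_ofReal (le_of_mem_hardSupport hA (hx _)))
    simpa using this
  have hmax : ENNReal.ofReal (B + B ^ 2 * A * (1 - (1 - B⁻¹) ^ n)) ≤
      ∫⁻ x : Fin n → ℝ, ENNReal.ofReal (orderStat x ⟨0, hn⟩)
        ∂(Measure.pi fun _ => hardInstance A B) := by
    have hprob := measure_one_le_hits n (hardInstance A B) (B + B ^ 2 * A)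
    rw [Measure.real, hardInstance_Ici hB hAB, ENNReal.toReal_ofReal (by positivity)] at hprob
    have hpow : (1 - B⁻¹) ^ n ≤ 1 :=
      pow_le_one₀ (by linarith) (by linarith [inv_pos.2 hB0])
    have hm : MeasurableSet {x : Fin n → ℝ | 1 ≤ hits (B + B ^ 2 * A) x} :=
      measurableSet_le measurable_const (measurable_hits _)
    calc ENNReal.ofReal (B + B ^ 2 * A * (1 - (1 - B⁻¹) ^ n))
        = ∫⁻ x : Fin n → ℝ, (ENNReal.ofReal B +
            {x : Fin n → ℝ | 1 ≤ hits (B + B ^ 2 * A) x}.indicator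
              (fun _ => ENNReal.ofReal (B ^ 2 * A)) x)
            ∂(Measure.pi fun _ => hardInstance A B) := by
          rw [lintegral_add_left measurable_const, lintegral_const, measure_univ, mul_one,
            lintegral_indicator_const hm, hprob, ← ENNReal.ofReal_mul (by linarith),
            ← ENNReal.ofReal_add hB0.le
              (mul_nonneg (by linarith) (by linarith))]
      _ ≤ _ := by
          refine lintegral_mono_ae (hae.mono fun x hx => ?_)
          by_cases h : 1 ≤ hits (B + B ^ 2 * A) x
          · obtain ⟨j, hj⟩ := Finset.card_pos.1 h
            simp only [Finset.mem_filter, Finset.mem_univ, true_and] at hj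
            rw [Set.indicator_of_mem (by exact h), ← ENNReal.ofReal_add hB0.le (by linarith)]
            exact ENNReal.ofReal_le_ofReal (hj.trans (le_orderStat_zero x rfl j))
          · rw [Set.indicator_of_notMem (by exact h), add_zero]
            exact ENNReal.ofReal_le_ofReal (le_of_mem_hardSupport hA (hx _))
  have hbern : (n / B) / (1 + n / B) ≤ 1 - (1 - B⁻¹) ^ n := by
    have h1 : (1 - B⁻¹) ^ n * (1 + n / B) ≤ 1 := by
      calc (1 - B⁻¹) ^ n * (1 + n / B) ≤ (1 - B⁻¹) ^ n * (1 + B⁻¹) ^ n := by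
            refine mul_le_mul_of_nonneg_left ?_ (pow_nonneg (by linarith) _)
            rw [div_eq_mul_inv]
            exact one_add_mul_le_pow (by linarith [inv_pos.2 hB0]) n
        _ = (1 - B⁻¹ ^ 2) ^ n := by rw [← mul_pow]; congr 1; ring
        _ ≤ 1 := pow_le_one₀ (by nlinarith [inv_pos.2 hB0]) (by nlinarith [inv_pos.2 hB0])
    rw [div_le_iff₀ (by positivity)]
    linarith
  have hzero : (⟨0, hn⟩ : Fin n) ∈ Finset.univ.filter (fun i : Fin n => (i : ℕ) < k) := by
    simp; omega
  unfold prophetValue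
  rw [← Finset.add_sum_erase _ _ hzero]
  have hrest : ENNReal.ofReal ((k - 1) * B) ≤
      ∑ i ∈ (Finset.univ.filter (fun i : Fin n => (i : ℕ) < k)).erase ⟨0, hn⟩,
        ∫⁻ x : Fin n → ℝ, ENNReal.ofReal (orderStat x i)
          ∂(Measure.pi fun _ => hardInstance A B) := by
    refine le_trans (le_of_eq ?_) (Finset.card_nsmul_le_sum _ _ _ fun i _ => hall i)
    rw [Finset.card_erase_of_mem hzero, card_filter_val_lt hkn, nsmul_eq_mul,
      ENNReal.ofReal_mul (by simpa using hk), ← ENNReal.ofReal_natCast, Nat.cast_sub hk,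
      Nat.cast_one]
  refine le_trans ?_ (add_le_add hmax hrest)
  have hk1 : (1 : ℝ) ≤ k := by exact_mod_cast hk
  rw [← ENNReal.ofReal_add]
  · refine ENNReal.ofReal_le_ofReal ?_
    have h1 : B ^ 2 * A * ((n / B) / (1 + n / B)) ≤ B ^ 2 * A * (1 - (1 - B⁻¹) ^ n) :=
      mul_le_mul_of_nonneg_left hbern (by linarith)
    have h2 : B * (k + n * A) / (1 + n / B) =
        B * k / (1 + n / B) + B ^ 2 * A * ((n / B) / (1 + n / B)) := by
      field_simp
    have h3 : B * k / (1 + n / B) ≤ B * k :=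
      div_le_self (by positivity) (by linarith [show 0 ≤ n / B by positivity])
    linarith
  · have : (0 : ℝ) ≤ (n / B) / (1 + n / B) := by positivity
    have := mul_nonneg (show 0 ≤ B ^ 2 * A by linarith) (this.trans hbern)
    linarith
  · exact mul_nonneg (by linarith) hB0.le

lemma algValue_hardInstance_le (m k : ℕ) (hB : 1 ≤ B) (hA : 0 ≤ A) (hAB : 1 ≤ B ^ 2 * A)
    {C : ℝ} (hC : ∀ q : ℝ, q ≤ 1 → (q + A) * ∑ j ∈ Finset.range m, (1 - q) ^ j ≤ C) {T : ℝ}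
    (hT : 0 ≤ T) : algValue m k (hardInstance A B) T ≤ ENNReal.ofReal ((B + 1) * (k * C)) := by
  have hp := isProbabilityMeasure_hardInstance hB hAB
  rw [algValue_eq m k _ hT]
  set q := (hardInstance A B).real (Set.Ici T) with hq
  have hq1 : q ≤ 1 := measureReal_le_one
  rcases (measureReal_nonneg : 0 ≤ q).eq_or_lt with h0 | h0
  · have : (hardInstance A B) (Set.Ici T) = 0 := by
      rw [← ofReal_measureReal, ← h0, ENNReal.ofReal_zero]
    rw [setLIntegral_measure_zero _ _ this, zero_mul]
    exact zero_le
  · have hopen := measure_Ici_mul_expectedOpen_le m k (hardInstance A B) T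
    have hgeom : 1 - (1 - q) ^ m = q * ∑ j ∈ Finset.range m, (1 - q) ^ j := by
      have := mul_neg_geom_sum (1 - q) m
      linarith
    have hsum : 0 ≤ ∑ j ∈ Finset.range m, (1 - q) ^ j :=
      Finset.sum_nonneg fun j _ => pow_nonneg (by linarith) _
    have hS : expectedOpen m k (hardInstance A B) T ≤
        ENNReal.ofReal (k * ∑ j ∈ Finset.range m, (1 - q) ^ j) := by
      rw [measure_one_le_hits, ← hq, hgeom, ← ofReal_measureReal, ← hq, ENNReal.ofReal_mul h0.le,
        ← mul_assoc, mul_comm (k : ℝ≥0∞), mul_assoc] at hopen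
      rw [ENNReal.ofReal_mul (Nat.cast_nonneg k), ENNReal.ofReal_natCast]
      exact (ENNReal.mul_le_mul_iff_right (by simpa using h0) ENNReal.ofReal_ne_top).1 hopen
    refine (mul_le_mul' (setLIntegral_hardInstance_le hB hA hAB T) hS).trans ?_
    rw [← ENNReal.ofReal_mul (by positivity)]
    refine ENNReal.ofReal_le_ofReal ?_
    have := mul_le_mul_of_nonneg_left (hC q hq1)
      (show 0 ≤ (B + 1) * k by positivity)
    calc _ = (B + 1) * k * ((q + A) * ∑ j ∈ Finset.range m, (1 - q) ^ j) := by ring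
      _ ≤ _ := this
      _ = _ := by ring

end HardInstance

/-- With `q₀ = k / n`, the value of the algorithm on the hard instance is maximized at the tangent
point `q₀`; there, the algorithm accepts nothing with probability `(1 - k / n) ^ m`. -/
lemma competitiveRatio_le {m n k : ℕ} (hm : 2 ≤ m) (hk : 1 ≤ k) (hkn : k < n) :
    competitiveRatio m n k ≤ ENNReal.ofReal (1 - (1 - (k : ℝ) / n) ^ m) := by
  have hn0 : (0 : ℝ) < n := by exact_mod_cast (by omega : 0 < n)
  have hk0 : (0 : ℝ) < k := by exact_mod_cast hk
  have hq₀ : (k : ℝ) / n < 1 := (div_lt_one hn0).2 (by exact_mod_cast hkn)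
  obtain ⟨A, hA, htan⟩ := exists_tangent hm hq₀
  set ρ : ℝ := 1 - (1 - (k : ℝ) / n) ^ m with hρ
  have hgeom : (k : ℝ) / n * ∑ j ∈ Finset.range m, (1 - (k : ℝ) / n) ^ j = ρ := by
    have := mul_neg_geom_sum (1 - (k : ℝ) / n) m
    linarith
  have hρ0 : 0 ≤ ρ := by
    have : (1 - (k : ℝ) / n) ^ m ≤ 1 :=
      pow_le_one₀ (by linarith) (by linarith [show 0 ≤ (k : ℝ) / n by positivity])
    linarith
  have hbound : ∀ B : ℝ, 1 ≤ B → 1 ≤ B ^ 2 * A →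
      competitiveRatio m n k ≤ ENNReal.ofReal ((1 + 1 / B) * (1 + n / B) * ρ) := by
    intro B hB hAB
    have hB0 : 0 < B := by linarith
    have hp := isProbabilityMeasure_hardInstance hB hAB
    refine (iInf₂_le _ (hardInstance_mem hB hA.le hAB)).trans ?_
    refine iSup₂_le fun q _ => iSup₂_le fun T hT => ?_
    refine (ENNReal.div_le_div (algValue_hardInstance_le m k hB hA.le hAB htan hT.1)
      (le_prophetValue_hardInstance hk hkn.le hB hA.le hAB)).trans ?_
    rw [← ENNReal.ofReal_div_of_pos (by positivity)]
    refine ENNReal.ofReal_le_ofReal (le_of_eq ?_)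
    rw [← hgeom]
    field_simp
  have hlim : Filter.Tendsto (fun B : ℝ => ENNReal.ofReal ((1 + 1 / B) * (1 + n / B) * ρ))
      Filter.atTop (nhds (ENNReal.ofReal ρ)) := by
    refine ENNReal.tendsto_ofReal ?_
    have h1 : Filter.Tendsto (fun B : ℝ => 1 / B) Filter.atTop (nhds 0) :=
      tendsto_const_nhds.div_atTop Filter.tendsto_id
    have h2 : Filter.Tendsto (fun B : ℝ => (n : ℝ) / B) Filter.atTop (nhds 0) :=
      tendsto_const_nhds.div_atTop Filter.tendsto_id
    simpa using ((h1.const_add 1).mul (h2.const_add 1)).mul_const ρ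
  refine ge_of_tendsto hlim ?_
  filter_upwards [Filter.eventually_ge_atTop 1, Filter.eventually_ge_atTop (1 / A)] with B h1 h2
  refine hbound B h1 ?_
  rw [div_le_iff₀ hA] at h2
  nlinarith

/-! ### From competitive ratios to scalings -/

lemma betaAt_le {k n m : ℕ} (hn : 0 < n) (hkm : k ≤ m) {ε b : ℝ}
    (hγ : ENNReal.ofReal (1 - ε) ≤ competitiveRatio m n k) (hm : (m : ℝ) ≤ b * n) :
    betaAt k n ε ≤ ENNReal.ofReal b := by
  have hn0 : (0 : ℝ) < n := by exact_mod_cast hn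
  refine (iInf₂_le m ⟨hkm, hγ⟩).trans ?_
  rw [← ENNReal.ofReal_natCast m, ← ENNReal.ofReal_natCast n, ← ENNReal.ofReal_div_of_pos hn0]
  exact ENNReal.ofReal_le_ofReal ((div_le_iff₀ hn0).2 hm)

/-- Since the competitive ratio increases with `m`, every `b > beta k ε` suffices. -/
lemma scalingBeta_le_beta {k : ℕ} (hk : 1 ≤ k) (ε : ℝ) : scalingBeta k ε ≤ beta k ε := by
  refine le_of_forall_gt_imp_ge_of_dense fun b hb => sInf_le ?_
  intro n m hkn hkm hbm
  have h1 : betaAt k n ε < b := (le_iSup₂ (f := fun n _ => betaAt k n ε) n hkn).trans_lt hb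
  unfold betaAt at h1
  simp only [iInf_lt_iff] at h1
  obtain ⟨m', ⟨-, hγ⟩, hlt⟩ := h1
  refine hγ.trans (competitiveRatio_mono ?_ n k)
  have hn0 : (n : ℝ≥0∞) ≠ 0 := by simp; omega
  have h2 : (m' : ℝ≥0∞) ≤ b * n :=
    (ENNReal.div_le_iff hn0 (ENNReal.natCast_ne_top n)).1 hlt.le
  exact_mod_cast h2.trans hbm

/-- The upper bound `1 - (1 - k / n) ^ m` on the ratio, solved for `m`. -/
lemma log_mul_le_of_le_competitiveRatio {m n k : ℕ} (hm : 2 ≤ m) (hk : 1 ≤ k) (hkn : k < n)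
    {ε : ℝ} (hε1 : ε < 1)
    (h : ENNReal.ofReal (1 - ε) ≤ competitiveRatio m n k) :
    Real.log (1 / ε) * ((n : ℝ) - k) ≤ m * k := by
  have hkn' : (k : ℝ) < n := by exact_mod_cast hkn
  have hk0 : (0 : ℝ) < k := by exact_mod_cast hk
  have hn0 : (0 : ℝ) < n := hk0.trans hkn'
  have hpos : 0 < 1 - (k : ℝ) / n := by
    rw [sub_pos, div_lt_one hn0]; exact hkn'
  have h1 := h.trans (competitiveRatio_le hm hk hkn)
  have h2 : (1 - (k : ℝ) / n) ^ m ≤ ε := by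
    rcases ENNReal.ofReal_le_ofReal_iff'.1 h1 with h | h <;> linarith
  have h3 := Real.log_le_log (pow_pos hpos m) h2
  rw [Real.log_pow] at h3
  have h4 := Real.one_sub_inv_le_log_of_pos hpos
  have h5 : 1 - (1 - (k : ℝ) / n)⁻¹ = -(k / (n - k)) := by
    have : (n : ℝ) - k ≠ 0 := (sub_pos.2 hkn').ne'
    field_simp
    ring
  rw [h5] at h4
  have h6 := mul_le_mul_of_nonneg_left h4 (Nat.cast_nonneg m (α := ℝ))
  rw [one_div, Real.log_inv, ← le_div_iff₀ (sub_pos.2 hkn'), mul_div_assoc]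
  linarith

lemma nonpos_of_mul_natCast_le {x C : ℝ} {k : ℕ} (h : ∀ n : ℕ, k < n → x * n ≤ C) : x ≤ 0 := by
  by_contra! hx
  obtain ⟨n, hn⟩ := exists_nat_gt (C / x)
  have h1 := h (max n (k + 1)) (by simp)
  have h2 : (n : ℝ) ≤ (max n (k + 1) : ℕ) := by exact_mod_cast le_max_left _ _
  rw [div_lt_iff₀ hx] at hn
  nlinarith

lemma ofReal_log_div_le_scalingBeta {k : ℕ} (hk : 1 ≤ k) {ε : ℝ} (hε : 0 < ε) (hε1 : ε < 1) :
    ENNReal.ofReal (Real.log (1 / ε) / k) ≤ scalingBeta k ε := by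
  refine le_sInf fun b hb => ?_
  induction b using ENNReal.recTopCoe with
  | top => exact le_top
  | coe b =>
    have hk0 : (0 : ℝ) < k := by exact_mod_cast hk
    have hL : 0 < Real.log (1 / ε) := Real.log_pos ((one_lt_div hε).2 hε1)
    refine ENNReal.ofReal_le_of_le_toReal ?_
    rw [ENNReal.coe_toReal, div_le_iff₀ hk0, ← sub_nonpos]
    refine nonpos_of_mul_natCast_le (k := k) (C := (Real.log (1 / ε) + (k + 2)) * k) fun n hn => ?_
    have hceil : (⌈(b : ℝ) * n⌉₊ : ℝ) ≤ b * n + 1 := (Nat.ceil_lt_add_one (by positivity)).le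
    have hm : (b : ℝ≥0∞) * n ≤ (⌈(b : ℝ) * n⌉₊ + (k + 1) : ℕ) := by
      have h1 : b * n ≤ ((⌈(b : ℝ) * n⌉₊ + (k + 1) : ℕ) : NNReal) := by
        rw [← NNReal.coe_le_coe]
        push_cast
        linarith [Nat.le_ceil ((b : ℝ) * n)]
      exact_mod_cast h1
    have h := log_mul_le_of_le_competitiveRatio (by omega) hk hn hε1
      (hb n _ hn.le (by omega) hm)
    push_cast at h
    nlinarith

lemma one_sub_inv_pow_le (n m : ℕ) (hn : 1 ≤ n) :
    (1 - 1 / (n : ℝ)) ^ m ≤ Real.exp (-(m / n)) := by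
  have hn1 : (1 : ℝ) ≤ n := by exact_mod_cast hn
  have h0 : 0 ≤ 1 - 1 / (n : ℝ) := by
    rw [sub_nonneg, div_le_one (by linarith)]; exact hn1
  calc (1 - 1 / (n : ℝ)) ^ m ≤ Real.exp (-(1 / n)) ^ m :=
        pow_le_pow_left₀ h0 (Real.one_sub_le_exp_neg _) _
    _ = _ := by rw [← Real.exp_nat_mul]; congr 1; ring

/-- The sharper estimate `log (n / (n - 1)) ≥ 1 / (n - 1 / 2)`. -/
lemma one_sub_inv_le_exp (n : ℕ) (hn : 1 ≤ n) :
    1 - 1 / (n : ℝ) ≤ Real.exp (-(2 / (2 * n - 1))) := by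
  rcases hn.eq_or_lt with rfl | hn
  · simpa using Real.exp_nonneg _
  have hn1 : (1 : ℝ) < n := by exact_mod_cast hn
  have hn2 : (0 : ℝ) < n - 1 := by linarith
  have hn3 : (0 : ℝ) < 2 * n - 1 := by linarith
  have h := Real.le_log_one_add_of_nonneg (x := 1 / ((n : ℝ) - 1)) (by positivity)
  have e1 : 2 * (1 / ((n : ℝ) - 1)) / (1 / ((n : ℝ) - 1) + 2) = 2 / (2 * n - 1) := by
    have : 1 + ((n : ℝ) - 1) * 2 ≠ 0 := by linarith
    field_simp
    ring
  have e2 : 1 - 1 / (n : ℝ) = (1 + 1 / ((n : ℝ) - 1))⁻¹ := by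
    have : (n : ℝ) - 1 + 1 ≠ 0 := by linarith
    field_simp
    ring
  rw [e1] at h
  rw [e2, ← Real.exp_log (show 0 < (1 + 1 / ((n : ℝ) - 1))⁻¹ by positivity), Real.log_inv]
  exact Real.exp_le_exp.2 (neg_le_neg h)

lemma exp_neg_log_one_div {ε : ℝ} (hε : 0 < ε) : Real.exp (-Real.log (1 / ε)) = ε := by
  rw [one_div, Real.log_inv, neg_neg, Real.exp_log hε]

lemma le_competitiveRatio_one_of_log_le {m n : ℕ} (hm : 0 < m) (hn : 1 ≤ n) {ε : ℝ} (hε : 0 < ε)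
    (h : Real.log (1 / ε) * n ≤ m) : ENNReal.ofReal (1 - ε) ≤ competitiveRatio m n 1 := by
  refine le_trans (ENNReal.ofReal_le_ofReal ?_) (le_competitiveRatio_one hm hn)
  have hn0 : (0 : ℝ) < n := by exact_mod_cast hn
  have h1 := one_sub_inv_pow_le n m hn
  have h2 : Real.exp (-(m / n)) ≤ ε := by
    rw [← exp_neg_log_one_div hε]
    exact Real.exp_le_exp.2 (neg_le_neg ((le_div_iff₀ hn0).2 h))
  linarith

lemma isSufficientScaling_one {ε : ℝ} (hε : 0 < ε) :
    IsSufficientScaling 1 ε (ENNReal.ofReal (Real.log (1 / ε))) := by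
  intro n m hn hm h
  refine le_competitiveRatio_one_of_log_le hm hn hε ?_
  rw [← ENNReal.ofReal_natCast n, ← ENNReal.ofReal_natCast m,
    ← ENNReal.ofReal_mul' (Nat.cast_nonneg n)] at h
  rcases ENNReal.ofReal_le_ofReal_iff'.1 h with h | h
  · exact h
  · exact h.trans (Nat.cast_nonneg m)

lemma betaAt_one_le {ε : ℝ} (hε : 0 < ε) (hε1 : ε < 1) {n : ℕ} (hn : 1 ≤ n) :
    betaAt 1 n ε ≤ ENNReal.ofReal (Real.log (1 / ε) + 1 / (n : ℝ)) := by
  have hn0 : (0 : ℝ) < n := by exact_mod_cast hn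
  have hL : 0 < Real.log (1 / ε) := Real.log_pos ((one_lt_div hε).2 hε1)
  have hm : 1 ≤ ⌈Real.log (1 / ε) * n⌉₊ := Nat.ceil_pos.2 (by positivity)
  refine betaAt_le hn hm (le_competitiveRatio_one_of_log_le hm hn hε (Nat.le_ceil _)) ?_
  have := (Nat.ceil_lt_add_one (show 0 ≤ Real.log (1 / ε) * n by positivity)).le
  rw [add_mul, one_div_mul_cancel hn0.ne']
  exact this

lemma le_betaAt_one {ε : ℝ} (hε1 : ε < 1) {n : ℕ} (hn : 1 < n) :
    ENNReal.ofReal (Real.log (1 / ε) - (Real.log (1 / ε) + 1) / (n : ℝ)) ≤ betaAt 1 n ε := by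
  have hn0 : (0 : ℝ) < n := by exact_mod_cast (by omega : 0 < n)
  refine le_iInf₂ fun m hm => ?_
  -- Passing from `m` to `m + 1` excludes `m = 1`, for which the tangent argument fails.
  have h := log_mul_le_of_le_competitiveRatio (m := m + 1) (by have := hm.1; omega) le_rfl hn
    hε1 (hm.2.trans (competitiveRatio_mono (Nat.le_succ m) n 1))
  push_cast at h
  rw [← ENNReal.ofReal_natCast m, ← ENNReal.ofReal_natCast n, ← ENNReal.ofReal_div_of_pos hn0]
  refine ENNReal.ofReal_le_ofReal ?_
  rw [le_div_iff₀ hn0, sub_mul, div_mul_cancel₀ _ hn0.ne']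
  linarith

lemma tendsto_betaAt_one {ε : ℝ} (hε : 0 < ε) (hε1 : ε < 1) :
    Filter.Tendsto (fun n : ℕ => betaAt 1 n ε) Filter.atTop
      (nhds (ENNReal.ofReal (Real.log (1 / ε)))) := by
  refine tendsto_of_tendsto_of_tendsto_of_le_of_le'
    (g := fun n : ℕ => ENNReal.ofReal (Real.log (1 / ε) - (Real.log (1 / ε) + 1) / (n : ℝ)))
    (h := fun n : ℕ => ENNReal.ofReal (Real.log (1 / ε) + 1 / (n : ℝ))) ?_ ?_
    ((Filter.eventually_gt_atTop 1).mono fun n hn => le_betaAt_one hε1 hn)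
    ((Filter.eventually_ge_atTop 1).mono fun n hn => betaAt_one_le hε hε1 hn)
  · refine ENNReal.tendsto_ofReal ?_
    simpa using (tendsto_const_div_atTop_nhds_zero_nat (Real.log (1 / ε) + 1)).const_sub
      (Real.log (1 / ε))
  · refine ENNReal.tendsto_ofReal ?_
    simpa using (tendsto_const_div_atTop_nhds_zero_nat (1 : ℝ)).const_add (Real.log (1 / ε))

lemma beta_one_le {ε : ℝ} (hε : 0 < ε) (hε2 : ε ≤ Real.exp (-2)) :
    beta 1 ε ≤ ENNReal.ofReal (Real.log (1 / ε)) := by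
  refine iSup₂_le fun n (hn : 1 ≤ n) => ?_
  have hn1 : (1 : ℝ) ≤ n := by exact_mod_cast hn
  have hL : 2 ≤ Real.log (1 / ε) := by
    have := Real.log_le_log hε hε2
    rw [Real.log_exp] at this
    rw [one_div, Real.log_inv]
    linarith
  set m := ⌊Real.log (1 / ε) * n⌋₊ with hmdef
  have hm1 : Real.log (1 / ε) * n < m + 1 := Nat.lt_floor_add_one _
  have hm : 1 ≤ m := Nat.le_floor (by push_cast; nlinarith)
  refine betaAt_le hn hm ?_ (Nat.floor_le (by positivity))
  refine le_trans (ENNReal.ofReal_le_ofReal ?_) (le_competitiveRatio_one hm hn)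
  have h0 : 0 ≤ 1 - 1 / (n : ℝ) := by
    rw [sub_nonneg, div_le_one (by linarith)]; exact hn1
  have h1 : (1 - 1 / (n : ℝ)) ^ m ≤ ε := by
    calc (1 - 1 / (n : ℝ)) ^ m ≤ Real.exp (-(2 / (2 * n - 1))) ^ m :=
          pow_le_pow_left₀ h0 (one_sub_inv_le_exp n hn) _
      _ = Real.exp (-(m * 2 / (2 * n - 1))) := by rw [← Real.exp_nat_mul]; congr 1; ring
      _ ≤ Real.exp (-Real.log (1 / ε)) := by
          refine Real.exp_le_exp.2 (neg_le_neg ?_)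
          -- The gain `log (1 / ε) / 2 ≥ 1` from the sharper estimate pays for the floor.
          rw [le_div_iff₀ (by linarith)]
          linarith
      _ = ε := exp_neg_log_one_div hε
  linarith

/-- For `m = ⌊a * n⌋` the rounding loss is at most `1 ≤ a * n / k`, which is why `k - 1` takes the
place of `k`. -/
lemma beta_le_of_chernoff {k : ℕ} (hk : 1 ≤ k) {a ε : ℝ} (ha : 1 ≤ a)
    (h : Real.exp (-(((k : ℝ) - 1) * (a - 1 - Real.log a))) ≤ ε) :
    beta k ε ≤ ENNReal.ofReal a := by
  refine iSup₂_le fun n (hn : k ≤ n) => ?_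
  have hk1 : (1 : ℝ) ≤ k := by exact_mod_cast hk
  have hkn : (k : ℝ) ≤ n := by exact_mod_cast hn
  have han : (k : ℝ) ≤ a * n := by nlinarith
  have hkm : k ≤ ⌊a * n⌋₊ := Nat.le_floor han
  refine betaAt_le (by omega) hkm ?_ (Nat.floor_le (by positivity))
  refine le_trans (ENNReal.ofReal_le_ofReal ?_)
    (le_competitiveRatio_chernoff (a := a) (r := k - 1) (by omega) hk hn ha le_rfl ?_)
  · linarith
  · have h1 : a * n < ⌊a * n⌋₊ + 1 := Nat.lt_floor_add_one _
    nlinarith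

lemma log_one_add_add_sq_le {x : ℝ} (hx : 0 ≤ x) : Real.log (1 + x ^ 2 + x) ≤ x + x ^ 2 / 2 := by
  rw [Real.log_le_iff_le_exp (by positivity)]
  have h := Real.quadratic_le_exp_of_nonneg (show 0 ≤ x + x ^ 2 / 2 by positivity)
  nlinarith [pow_nonneg hx 3, pow_nonneg hx 4]

lemma beta_le {k : ℕ} (hk : 1 < k) {ε : ℝ} (hε : 0 < ε) (hε1 : ε < 1) :
    beta k ε ≤ ENNReal.ofReal (1 + 2 * Real.log (1 / ε) / ((k : ℝ) - 1) +
      Real.sqrt (2 * Real.log (1 / ε) / ((k : ℝ) - 1))) := by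
  have hk1 : (0 : ℝ) < (k : ℝ) - 1 := by
    rw [sub_pos]; exact_mod_cast hk
  have hL : 0 < Real.log (1 / ε) := Real.log_pos ((one_lt_div hε).2 hε1)
  set s := 2 * Real.log (1 / ε) / ((k : ℝ) - 1) with hs
  have hs0 : 0 ≤ s := by positivity
  have hsL : ((k : ℝ) - 1) * (s / 2) = Real.log (1 / ε) := by rw [hs]; field_simp
  have hx := Real.sqrt_nonneg s
  refine beta_le_of_chernoff hk.le (by linarith) ?_
  rw [← exp_neg_log_one_div hε, ← hsL]
  refine Real.exp_le_exp.2 (neg_le_neg (mul_le_mul_of_nonneg_left ?_ hk1.le))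
  have h := log_one_add_add_sq_le hx
  rw [Real.sq_sqrt hs0] at h
  linarith

lemma beta_one_le_of_le_one {c a : ℝ} (hc : c ≤ 1) (ha : 1 ≤ a) :
    beta 1 (Real.exp (-c)) ≤ ENNReal.ofReal a := by
  refine iSup₂_le fun n (hn : 1 ≤ n) => ?_
  refine betaAt_le hn hn (le_competitiveRatio_one_of_log_le hn hn (Real.exp_pos _) ?_)
    (le_mul_of_one_le_left (Nat.cast_nonneg n) ha)
  rw [one_div, Real.log_inv, Real.log_exp, neg_neg]
  exact mul_le_of_le_one_left (Nat.cast_nonneg n) hc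

lemma iInf_competitiveRatio_le {δ : ℝ} (hδ : 0 < δ) {k : ℕ} (hk : 1 ≤ k) :
    (⨅ n ∈ Set.Ici k, competitiveRatio ⌈(1 + δ) * (n : ℝ)⌉₊ n k) ≤
      ENNReal.ofReal (1 - Real.exp (-((Real.log 2 * (3 + 2 * δ)) * (k : ℝ)))) := by
  have hk1 : (1 : ℝ) ≤ k := by exact_mod_cast hk
  refine (iInf₂_le (2 * k) (by simp; omega)).trans ?_
  set m := ⌈(1 + δ) * ((2 * k : ℕ) : ℝ)⌉₊ with hm
  have hm1 : (m : ℝ) ≤ (1 + δ) * (2 * k) + 1 := by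
    have := (Nat.ceil_lt_add_one (show 0 ≤ (1 + δ) * ((2 * k : ℕ) : ℝ) by positivity)).le
    rw [hm]
    push_cast at this ⊢
    exact this
  have hm2 : 2 ≤ m := by
    have h1 : (1 + δ) * ((2 * k : ℕ) : ℝ) ≤ m := Nat.le_ceil _
    have h2 : (2 : ℝ) ≤ m := by
      push_cast at h1
      nlinarith
    exact_mod_cast h2
  refine (competitiveRatio_le hm2 hk (by omega)).trans (ENNReal.ofReal_le_ofReal ?_)
  have hhalf : 1 - (k : ℝ) / ((2 * k : ℕ) : ℝ) = Real.exp (-Real.log 2) := by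
    rw [Real.exp_neg, Real.exp_log two_pos]
    push_cast
    field_simp
    norm_num
  rw [hhalf, ← Real.exp_nat_mul]
  refine sub_le_sub_left (Real.exp_le_exp.2 ?_) _
  have hl : 0 < Real.log 2 := Real.log_pos one_lt_two
  nlinarith

end SingleThreshold

theorem mainTheorem2 :
    (∀ ε : ℝ, 0 < ε → ε < 1 →
      SingleThreshold.scalingBeta 1 ε = ENNReal.ofReal (Real.log (1 / ε)) ∧
      SingleThreshold.IsSufficientScaling 1 ε (ENNReal.ofReal (Real.log (1 / ε))) ∧
      (∀ n : ℕ, 1 ≤ n →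
        SingleThreshold.betaAt 1 n ε ≤ ENNReal.ofReal (Real.log (1 / ε) + 1 / (n : ℝ))) ∧
      Filter.Tendsto (fun n : ℕ => SingleThreshold.betaAt 1 n ε) Filter.atTop
        (nhds (ENNReal.ofReal (Real.log (1 / ε)))) ∧
      (ε ≤ Real.exp (-2) →
        SingleThreshold.beta 1 ε = ENNReal.ofReal (Real.log (1 / ε)))) ∧
    (∀ k : ℕ, 1 < k → ∀ ε : ℝ, 0 < ε → ε < 1 →
      ENNReal.ofReal (Real.log (1 / ε) / (k : ℝ)) ≤ SingleThreshold.scalingBeta k ε ∧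
      SingleThreshold.scalingBeta k ε ≤ SingleThreshold.beta k ε ∧
      SingleThreshold.beta k ε ≤
        ENNReal.ofReal (1 + 2 * Real.log (1 / ε) / ((k : ℝ) - 1) +
          Real.sqrt (2 * Real.log (1 / ε) / ((k : ℝ) - 1)))) ∧
    (∀ δ : ℝ, 0 < δ → ∃ c C : ℝ, 0 < c ∧ 0 < C ∧ ∀ k : ℕ, 1 ≤ k →
      SingleThreshold.beta k (Real.exp (-(c * (k : ℝ)))) ≤ ENNReal.ofReal (1 + δ) ∧
      (∀ n m : ℕ, k ≤ n → (1 + δ) * (n : ℝ) ≤ (m : ℝ) →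
        ENNReal.ofReal (1 - Real.exp (-(c * (k : ℝ)))) ≤
          SingleThreshold.competitiveRatio m n k) ∧
      (⨅ n ∈ Set.Ici k, SingleThreshold.competitiveRatio ⌈(1 + δ) * (n : ℝ)⌉₊ n k) ≤
        ENNReal.ofReal (1 - Real.exp (-(C * (k : ℝ))))) := by
  refine ⟨fun ε hε hε1 => ?_, fun k hk ε hε hε1 => ?_, fun δ hδ => ?_⟩
  · have hlow : ENNReal.ofReal (Real.log (1 / ε)) ≤ SingleThreshold.scalingBeta 1 ε := by
      simpa using SingleThreshold.ofReal_log_div_le_scalingBeta le_rfl hε hε1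
    exact ⟨le_antisymm (sInf_le (SingleThreshold.isSufficientScaling_one hε)) hlow,
      SingleThreshold.isSufficientScaling_one hε,
      fun n hn => SingleThreshold.betaAt_one_le hε hε1 hn,
      SingleThreshold.tendsto_betaAt_one hε hε1,
      fun hε2 => le_antisymm (SingleThreshold.beta_one_le hε hε2)
        (hlow.trans (SingleThreshold.scalingBeta_le_beta le_rfl ε))⟩
  · exact ⟨SingleThreshold.ofReal_log_div_le_scalingBeta hk.le hε hε1,
      SingleThreshold.scalingBeta_le_beta hk.le ε, SingleThreshold.beta_le hk hε hε1⟩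
  · have hκ : 0 < (1 + δ) - 1 - Real.log (1 + δ) := by
      have := Real.log_lt_sub_one_of_pos (show 0 < 1 + δ by linarith) (by linarith)
      linarith
    set κ := (1 + δ) - 1 - Real.log (1 + δ) with hκdef
    have hc1 : min 1 (κ / 2) ≤ 1 := min_le_left _ _
    have hc2 : min 1 (κ / 2) ≤ κ / 2 := min_le_right _ _
    have hl : 0 < Real.log 2 := Real.log_pos one_lt_two
    refine ⟨min 1 (κ / 2), Real.log 2 * (3 + 2 * δ), lt_min one_pos (by linarith),
      by positivity, fun k hk => ⟨?_, ?_, SingleThreshold.iInf_competitiveRatio_le hδ hk⟩⟩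
    · rcases hk.eq_or_lt with rfl | hk
      · simpa using SingleThreshold.beta_one_le_of_le_one hc1 (show 1 ≤ 1 + δ by linarith)
      · -- For `k ≥ 2`, `k / 2 ≤ k - 1`.
        have hk2 : (2 : ℝ) ≤ k := by exact_mod_cast hk
        refine SingleThreshold.beta_le_of_chernoff hk.le (by linarith) (Real.exp_le_exp.2 ?_)
        rw [← hκdef]
        nlinarith
    · intro n m hkn hmn
      have hk1 : (1 : ℝ) ≤ k := by exact_mod_cast hk
      have hn1 : (1 : ℝ) ≤ n := by exact_mod_cast hk.trans hkn
      have hm : 0 < m := by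
        have : (0 : ℝ) < m := by nlinarith
        exact_mod_cast this
      refine le_trans (ENNReal.ofReal_le_ofReal (sub_le_sub_left (Real.exp_le_exp.2 ?_) _))
        (SingleThreshold.le_competitiveRatio_chernoff (a := 1 + δ) (r := k) hm hk hkn
          (by linarith) (by linarith) (by nlinarith))
      rw [← hκdef]
      nlinarith
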